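/- Write $\{\pm1\}$-valued functions as Boolean functions. For a class $C$ of Boolean functions over a domain $X$, the margin complexity $\mathrm{mc}(C)$ is the least $M\ge 0$ such that for some $d$ there is a map $\Psi$ from $X$ to the unit ball $B^d(1)$ of $\ell_2^d$ with the property that for every $f\in C$ there is $w\in B^d(1)$ with $f(x)\langle w,\Psi(x)\rangle\ge 1/M$ for all $x\in X$ (and $\mathrm{mc}(C)=\infty$ if there is no such $M$). An $\varepsilon$-local randomizer on $Z$ is a randomized map $R:Z\to W$ with $\Pr[R(z_1)=w]\le e^{\varepsilon}\Pr[R(z_2)=w]$ for all $z_1,z_2\in Z$, $w\in W$. For a dataset $S=(z_1,\dots,z_n)\in Z^n$, a call $\mathrm{LR}_S(i,R)$ returns a fresh random value of $R(z_i)$. A non-interactive $\varepsilon$-LDP algorithm using $n$ examples is a randomized algorithm that accesses $S\in Z^n$ only through finitely many calls $\mathrm{LR}_S(i,R)$, all determined before any answer is observed, such that for each $i$ the privacy parameters of the randomizers applied to $z_i$ sum to at most $\varepsilon$. Theorem. There is a (universal) polynomial $p$ such that the following holds. Let $C$ be a class of (measurable) Boolean functions over $X$ with $\mathrm{mc}(C)<\infty$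 (which always holds if $X$ is finite), and let $D$ be an arbitrary probability distribution over $X$. For all $\alpha,\varepsilon>0$ there are $$n\le p\!\left(\frac{\mathrm{mc}(C)}{\alpha\,\min(\varepsilon,1)}\right)$$ and a non-interactive $\varepsilon$-LDP algorithm using $n$ examples (which may depend on $C$, $D$, $\alpha$, $\varepsilon$) that PAC learns $C$ relative to $D$ with accuracy $1-\alpha$: for every $f\in C$, when run on $n$ i.i.d. examples $(x,f(x))$, $x\sim D$, it outputs, with probability at least $2/3$, a function $h:X\to\{\pm1\}$ with $\Pr_{x\sim D}[f(x)\ne h(x)]\le\alpha$. -/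

import Mathlib

open MeasureTheory
open scoped ENNReal

noncomputable section

namespace LDPLearning

/-- `C` is realised with margin `1 / M`: for some dimension `d` there is a map `Ψ` of the domain into
the closed Euclidean unit ball of `ℝ^d` such that every `f ∈ C` (a `{1, -1}`-valued function) is
given by a vector `w` of the unit ball with `f x * ⟪w, Ψ x⟫ ≥ 1 / M` at every point `x`. -/
def RealizableWithMargin {X : Type*} (C : Set (X → ℤˣ)) (M : ℝ) : Prop :=
  ∃ (d : ℕ) (Ψ : X → EuclideanSpace ℝ (Fin d)), (∀ x, ‖Ψ x‖ ≤ 1) ∧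
    ∀ f ∈ C, ∃ w : EuclideanSpace ℝ (Fin d), ‖w‖ ≤ 1 ∧
      ∀ x, 1 / M ≤ ((f x : ℤ) : ℝ) * inner ℝ w (Ψ x)

/-- The margin complexity of `C`: the least `M` such that `C` is realised with margin `1 / M`
(`⊤` if there is no such `M`). -/
def marginComplexity {X : Type*} (C : Set (X → ℤˣ)) : ℝ≥0∞ :=
  ⨅ (M : ℝ) (_ : 0 < M ∧ RealizableWithMargin C M), ENNReal.ofReal M

/-- An `ε`-local randomizer on `Z`: a randomized map `R : Z → W` with discretely distributed values
such that `Pr[R z₁ = w] ≤ e ^ ε * Pr[R z₂ = w]` for all `z₁`, `z₂`, `w`. -/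
structure LocalRandomizer (Z : Type*) [MeasurableSpace Z] (ε : ℝ) where
  W : Type
  law : Z → PMF W
  measurable_law : ∀ w, Measurable fun z => law z w
  law_le : ∀ z₁ z₂ w, law z₁ w ≤ ENNReal.ofReal (Real.exp ε) * law z₂ w

/-- A call `LR_S (i, R)` to the local randomizer oracle of a dataset `S ∈ Z ^ n`: an index `i` and an
`eps`-local randomizer `R`, which the oracle answers by a random value of `R (S i)`. -/
structure OracleCall (Z : Type*) [MeasurableSpace Z] (n : ℕ) where
  index : Fin n
  eps : ℝ
  eps_nonneg : 0 ≤ eps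
  randomizer : LocalRandomizer Z eps

/-- A non-interactive `ε`-LDP procedure on datasets in `Z ^ n` with output in `H`, for fixed internal
coins: finitely many oracle calls, all fixed in advance, such that on each index the privacy
parameters of the calls sum up to at most `ε`, and the output computed from the answers. -/
structure NonInteractiveProcedure (Z : Type*) [MeasurableSpace Z] (H : Type*) (ε : ℝ) (n : ℕ) where
  numCalls : ℕ
  call : Fin numCalls → OracleCall Z n
  budget : ∀ i : Fin n, ∑ j with (call j).index = i, (call j).eps ≤ ε
  output : (∀ j, (call j).randomizer.W) → H

/-- The probability that the output lies in `E` when the procedure is run on the dataset `S`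
(the oracle answers distinct calls with independent randomness). -/
def NonInteractiveProcedure.probOn {Z : Type*} [MeasurableSpace Z] {H : Type*} {ε : ℝ} {n : ℕ}
    (B : NonInteractiveProcedure Z H ε n) (S : Fin n → Z) (E : Set H) : ℝ≥0∞ :=
  ∑' r : {r : ∀ j, (B.call j).randomizer.W // B.output r ∈ E},
    ∏ j, (B.call j).randomizer.law (S (B.call j).index) (r.1 j)

/-- A (randomized) non-interactive `ε`-LDP algorithm using `n` examples: internal coins are tossed
first and determine all the oracle calls, before any answer is observed, as well as the map from the
answers to the output. -/
structure NonInteractiveLDPAlgorithm (Z : Type*) [MeasurableSpace Z] (H : Type*) (ε : ℝ)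
    (n : ℕ) where
  Coins : Type
  coins : PMF Coins
  procedure : Coins → NonInteractiveProcedure Z H ε n

/-- The probability that the output lies in `E` when the algorithm is run on a dataset of `n`
independent samples from `P`; over the coins, the samples and the local randomizers. -/
def NonInteractiveLDPAlgorithm.prob {Z : Type*} [MeasurableSpace Z] {H : Type*} {ε : ℝ} {n : ℕ}
    (A : NonInteractiveLDPAlgorithm Z H ε n) (P : Measure Z) (E : Set H) : ℝ≥0∞ :=
  ∑' c, A.coins c * ∫⁻ S, (A.procedure c).probOn S E ∂(Measure.pi fun _ : Fin n => P)

/-- The distribution of the labeled example `(x, f x)` for `x ∼ D`. -/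
def exampleDistribution {X : Type*} [MeasurableSpace X] (D : Measure X) (f : X → ℤˣ) :
    Measure (X × ℤˣ) :=
  D.map fun x => (x, f x)

/-- The algorithm PAC learns `C` relative to `D` with error `α` (accuracy `1 - α`): for every target
`f ∈ C`, with probability at least `2 / 3` it outputs `h` with `Pr_{x ∼ D}[f x ≠ h x] ≤ α`. -/
def PACLearnsRelativeTo {X : Type*} [MeasurableSpace X] {ε : ℝ} {n : ℕ}
    (A : NonInteractiveLDPAlgorithm (X × ℤˣ) {h : X → ℤˣ // Measurable h} ε n)
    (C : Set (X → ℤˣ)) (D : Measure X) (α : ℝ) : Prop :=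
  ∀ f ∈ C, 2 / 3 ≤ A.prob (exampleDistribution D f)
    {h | D {x | f x ≠ h.1 x} ≤ ENNReal.ofReal α}

end LDPLearning

end

open ProbabilityTheory

noncomputable section

namespace LDPLearning

/-! Since `D` is known, the learner only has to estimate a few correlations of the labels. Let `Ψ`
realise the margin `1 / M`. As `‖Ψ x‖ ≤ 1`, the second moment form of `Ψ` under `D` has trace at
most 1, so at most `1 / t ^ 2` orthonormal directions `u i` have second moment at least `t ^ 2`. For
a system of maximal size, every `w` of the unit ball orthogonal to it has second moment at most `t ^
2` (`exists_orthonormal_second_moment_le`).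

Let `w` realise `f`, and let the correlations of `f` and `g` with the features `⟪u i, Ψ x⟫` be `2 *
t`-close in Euclidean norm. The mean of `(f - g) * ⟪w, Ψ⟫` is then at most `4 * t`: the part of `w`
along the `u i` contributes at most `2 * t` by closeness, the remainder at most `2 * t` by its small
second moment. The margin bounds the same mean below by `2 / M` times the probability that `f ≠ g`,
so this probability is at most `2 * M * t` (`measure_ne_le_of_correlation_close`). The vector `w` is
never computed.

The correlations are estimated by randomized response, one bit per example and one group of examples
per direction (`correlationAlgorithm_prob`, `two_thirds_le_groupMean_close`). Any member of `C`
matching the estimates is a valid output. -/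

instance : MeasurableSingletonClass ℤˣ where
  measurableSet_singleton u := by
    refine ⟨{(u : ℤ)}, measurableSet_singleton _, ?_⟩
    ext v
    simp [Units.ext_iff]

/-! ### Margin realisations: finiteness, measurability, size of the margin -/

section Margin

variable {X : Type*} {C : Set (X → ℤˣ)} {M : ℝ}

/-- A class realised with positive margin in finite dimension is finite: the vectors realising
distinct functions are separated. -/
theorem RealizableWithMargin.finite (hM : 0 < M) (h : RealizableWithMargin C M) : C.Finite := by
  obtain ⟨d, Ψ, hΨ, h⟩ := h
  choose! w hw hwf using h
  obtain ⟨t, -, ht, hcov⟩ := finite_cover_balls_of_compact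
    (isCompact_closedBall (0 : EuclideanSpace ℝ (Fin d)) 1) (e := 1 / M) (by positivity)
  have hc : ∀ f ∈ C, ∃ y ∈ t, dist (w f) y < 1 / M := by
    intro f hf
    simpa using hcov (show w f ∈ Metric.closedBall 0 1 by simpa using hw f hf)
  choose! c hct hc using hc
  -- Functions sharing a net point have vectors less than `2 / M` apart, but where they disagree the
  -- two margins add up to a gap of `2 / M`.
  refine Set.Finite.of_finite_image (ht.subset (Set.image_subset_iff.2 hct)) ?_
  intro f hf g hg hfg
  by_contra hne
  obtain ⟨x, hx⟩ := Function.ne_iff.1 hne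
  have hd : ‖w f - w g‖ < 2 / M := by
    rw [← dist_eq_norm]
    have h1 := hc f hf
    have h2 := hc g hg
    rw [← hfg] at h2
    have h3 := dist_triangle_right (w f) (w g) (c f)
    have h4 : 2 / M = 1 / M + 1 / M := by ring
    linarith
  have hi : |inner ℝ (w f - w g) (Ψ x)| < 2 / M :=
    ((abs_real_inner_le_norm _ _).trans
      (mul_le_of_le_one_right (norm_nonneg _) (hΨ x))).trans_lt hd
  have hf' := hwf f hf x
  have hg' := hwf g hg x
  rw [inner_sub_left, abs_lt] at hi
  have h4 : 2 / M = 1 / M + 1 / M := by ring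
  rcases Int.units_eq_one_or (f x) with h1 | h1 <;> rcases Int.units_eq_one_or (g x) with h2 | h2 <;>
    simp [h1, h2] at hx hf' hg' hi h4 <;> linarith

/-- For a class of measurable functions, the embedding realising a margin may be taken
measurable. -/
theorem RealizableWithMargin.exists_measurable [MeasurableSpace X]
    (hC : ∀ f ∈ C, Measurable f) (hM : 0 < M) (h : RealizableWithMargin C M) :
    ∃ (d : ℕ) (Ψ : X → EuclideanSpace ℝ (Fin d)), Measurable Ψ ∧ (∀ x, ‖Ψ x‖ ≤ 1) ∧
      ∀ f ∈ C, ∃ w : EuclideanSpace ℝ (Fin d), ‖w‖ ≤ 1 ∧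
        ∀ x, 1 / M ≤ ((f x : ℤ) : ℝ) * inner ℝ w (Ψ x) := by
  have := (h.finite hM).to_subtype
  obtain ⟨d, Ψ, hΨ, h⟩ := h
  rcases isEmpty_or_nonempty X with hX | hX
  · exact ⟨d, Ψ, measurable_of_empty _, hΨ, h⟩
  let T : X → C → ℤˣ := fun x f => f.1 x
  have hT : Measurable T := measurable_pi_lambda _ fun f => hC f f.2
  -- Replacing `x` by a chosen point with the same labels under all of `C` keeps the margins and
  -- makes the embedding factor through the finite space of label patterns.
  let r : X → X := fun x => Function.invFun T (T x)
  have hr : ∀ x, T (r x) = T x := fun x => Function.invFun_eq ⟨x, rfl⟩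
  refine ⟨d, fun x => Ψ (r x), ?_, fun x => hΨ _, fun f hf => ?_⟩
  · have : MeasurableSingletonClass (C → ℤˣ) := Pi.instMeasurableSingletonClass
    exact (measurable_of_finite fun y => Ψ (Function.invFun T y)).comp hT
  · obtain ⟨w, hw, hwf⟩ := h f hf
    refine ⟨w, hw, fun x => ?_⟩
    have := hwf (r x)
    rwa [show f (r x) = f x from congrFun (hr x) ⟨f, hf⟩] at this

/-- A class containing a function on a nonempty domain has margin at most one. -/
theorem one_le_of_realizable [Nonempty X] (hC : C.Nonempty) (hM : 0 < M)
    (h : RealizableWithMargin C M) : 1 ≤ M := by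
  obtain ⟨d, Ψ, hΨ, h⟩ := h
  obtain ⟨f, hf⟩ := hC
  obtain ⟨w, hw, hwf⟩ := h f hf
  obtain ⟨x⟩ := ‹Nonempty X›
  have h1 := hwf x
  have h2 : |inner ℝ w (Ψ x)| ≤ 1 :=
    (abs_real_inner_le_norm _ _).trans (mul_le_one₀ hw (norm_nonneg _) (hΨ x))
  have h3 : 1 / M ≤ 1 := by
    rw [abs_le] at h2
    rcases Int.units_eq_one_or (f x) with h | h <;> simp [h] at h1 ⊢ <;> linarith
  rwa [div_le_one hM] at h3

/-- A finite margin complexity is at least one and attained up to a factor of two. -/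
theorem exists_realizable_le_two_mul_marginComplexity [Nonempty X] (hC : C.Nonempty)
    (h : marginComplexity C ≠ ⊤) :
    1 ≤ (marginComplexity C).toReal ∧
      ∃ M, 0 < M ∧ RealizableWithMargin C M ∧ M ≤ 2 * (marginComplexity C).toReal := by
  have h1 : 1 ≤ marginComplexity C := by
    refine le_iInf₂ fun M hM => ?_
    rw [← ENNReal.ofReal_one]
    exact ENNReal.ofReal_le_ofReal (one_le_of_realizable hC hM.1 hM.2)
  have h1' : 1 ≤ (marginComplexity C).toReal := by
    simpa using ENNReal.toReal_mono h h1
  refine ⟨h1', ?_⟩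
  have h2 : marginComplexity C < ENNReal.ofReal (2 * (marginComplexity C).toReal) := by
    rw [← ENNReal.toReal_lt_toReal h ENNReal.ofReal_ne_top, ENNReal.toReal_ofReal (by positivity)]
    linarith
  obtain ⟨M, hM⟩ := iInf_lt_iff.1 h2
  obtain ⟨hM, hlt⟩ := iInf_lt_iff.1 hM
  exact ⟨M, hM.1, hM.2, ((ENNReal.ofReal_lt_ofReal_iff (by linarith)).1 hlt).le⟩

end Margin

/-! ### Directions of large second moment -/

section SecondMoment

variable {X E : Type*} [MeasurableSpace X] [NormedAddCommGroup E] [InnerProductSpace ℝ E]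
  [MeasurableSpace E] [BorelSpace E] [SecondCountableTopology E]
  (D : Measure X) [IsProbabilityMeasure D] {Ψ : X → E}

theorem integrable_inner_sq (hΨ : Measurable Ψ) (hb : ∀ x, ‖Ψ x‖ ≤ 1) (u : E) :
    Integrable (fun x => (inner ℝ u (Ψ x)) ^ 2) D := by
  refine Integrable.of_bound (C := ‖u‖ ^ 2)
    (((measurable_const (a := u)).inner hΨ).pow_const 2).aestronglyMeasurable
    (ae_of_all _ fun x => ?_)
  rw [norm_pow]
  gcongr
  exact (norm_inner_le_norm _ _).trans (mul_le_of_le_one_right (norm_nonneg _) (hb x))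

/-- Orthonormal directions of large second moment are few, hence there is a maximal system of
them. -/
theorem exists_orthonormal_second_moment_le (hΨ : Measurable Ψ) (hb : ∀ x, ‖Ψ x‖ ≤ 1)
    {l : ℝ} (hl : 0 < l) :
    ∃ (k : ℕ) (u : Fin k → E), Orthonormal ℝ u ∧ k * l ≤ 1 ∧
      ∀ w : E, ‖w‖ ≤ 1 → (∀ i, inner ℝ w (u i) = 0) → ∫ x, (inner ℝ w (Ψ x)) ^ 2 ∂D ≤ l := by
  classical
  let P : ℕ → Prop := fun k => ∃ u : Fin k → E, Orthonormal ℝ u ∧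
    ∀ i, l ≤ ∫ x, (inner ℝ (u i) (Ψ x)) ^ 2 ∂D
  have hP : ∀ k, P k → k * l ≤ 1 := by
    rintro k ⟨u, hu, hul⟩
    calc k * l = ∑ _i : Fin k, l := by simp
      _ ≤ ∑ i, ∫ x, (inner ℝ (u i) (Ψ x)) ^ 2 ∂D := Finset.sum_le_sum fun i _ => hul i
      _ = ∫ x, ∑ i, (inner ℝ (u i) (Ψ x)) ^ 2 ∂D :=
        (integral_finsetSum _ fun i _ => integrable_inner_sq D hΨ hb _).symm
      _ ≤ ∫ _x, (1 : ℝ) ∂D := by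
        refine integral_mono (integrable_finsetSum _ fun i _ => integrable_inner_sq D hΨ hb _)
          (integrable_const _) fun x => ?_
        -- Bessel's inequality at each point.
        have := hu.sum_inner_products_le (Ψ x) (s := Finset.univ)
        simp only [Real.norm_eq_abs, sq_abs] at this
        exact this.trans (pow_le_one₀ (norm_nonneg _) (hb x))
      _ = 1 := by simp
  have hbound : ∀ k, P k → k ≤ ⌊1 / l⌋₊ := fun k hk =>
    Nat.le_floor ((le_div_iff₀ hl).2 (hP k hk))
  have h0 : P 0 := ⟨Fin.elim0, ⟨fun i => i.elim0, fun i => i.elim0⟩, fun i => i.elim0⟩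
  have hk : P (Nat.findGreatest P ⌊1 / l⌋₊) := Nat.findGreatest_spec (Nat.zero_le _) h0
  obtain ⟨u, hu, hul⟩ := id hk
  refine ⟨_, u, hu, hP _ hk, fun w hw hwu => ?_⟩
  by_contra! hlt
  have hw0 : 0 < ‖w‖ := by
    rw [norm_pos_iff]
    rintro rfl
    simp at hlt
    linarith
  -- Normalising `w` can only increase its second moment, so it would extend the largest system.
  have hs : P (Nat.findGreatest P ⌊1 / l⌋₊ + 1) := by
    refine ⟨Matrix.vecCons (‖w‖⁻¹ • w) u, orthonormal_vecCons_iff.2 ⟨?_, fun i => ?_, hu⟩, ?_⟩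
    · rw [norm_smul, norm_inv, norm_norm, inv_mul_cancel₀ hw0.ne']
    · rw [inner_smul_left, hwu, mul_zero]
    · refine Fin.cases ?_ fun i => by simpa using hul i
      simp only [Matrix.cons_val_zero, real_inner_smul_left, mul_pow, integral_const_mul]
      refine hlt.le.trans (le_mul_of_one_le_left (hl.trans hlt).le ?_)
      exact one_le_pow₀ ((one_le_inv₀ hw0).2 hw)
  have := Nat.le_findGreatest (hbound _ hs) hs
  omega

end SecondMoment

/-! ### Correlations determine a function of the class up to small error -/

section Separation

variable {X : Type*} [MeasurableSpace X]

theorem measurable_unit_cast {f : X → ℤˣ} (hf : Measurable f) :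
    Measurable fun x => ((f x : ℤ) : ℝ) :=
  (measurable_of_finite fun u : ℤˣ => ((u : ℤ) : ℝ)).comp hf

theorem abs_unit_cast (u : ℤˣ) : |((u : ℤ) : ℝ)| = 1 := by
  rcases Int.units_eq_one_or u with h | h <;> simp [h]

/-- The correlation of the labels `f` with the feature `φ`. -/
def correlation (D : Measure X) (f : X → ℤˣ) (φ : X → ℝ) : ℝ :=
  ∫ x, ((f x : ℤ) : ℝ) * φ x ∂D

theorem integrable_unit_mul (D : Measure X) [IsProbabilityMeasure D] {f : X → ℤˣ}
    (hf : Measurable f) {φ : X → ℝ} (hφ : Measurable φ) {B : ℝ} (hb : ∀ x, |φ x| ≤ B) :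
    Integrable (fun x => ((f x : ℤ) : ℝ) * φ x) D :=
  Integrable.of_bound ((measurable_unit_cast hf).mul hφ).aestronglyMeasurable B
    (ae_of_all _ fun x => by simpa [abs_mul, abs_unit_cast] using hb x)

theorem abs_correlation_le (D : Measure X) [IsProbabilityMeasure D] (f : X → ℤˣ) {φ : X → ℝ}
    (hb : ∀ x, |φ x| ≤ 1) : |correlation D f φ| ≤ 1 := by
  have h := norm_integral_le_of_norm_le_const (μ := D) (C := 1)
    (f := fun x => ((f x : ℤ) : ℝ) * φ x)
    (ae_of_all _ fun x => by simpa [abs_mul, abs_unit_cast] using hb x)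
  simpa [correlation] using h

variable {E : Type*} [NormedAddCommGroup E] [InnerProductSpace ℝ E]
  [MeasurableSpace E] [BorelSpace E] [SecondCountableTopology E]
  (D : Measure X) [IsProbabilityMeasure D] {Ψ : X → E}

/-- Functions with nearly the same correlations with the main directions are close to each other,
if one of them is realised with a margin. -/
theorem measure_ne_le_of_correlation_close (hΨ : Measurable Ψ) (hb : ∀ x, ‖Ψ x‖ ≤ 1)
    {f g : X → ℤˣ} (hf : Measurable f) (hg : Measurable g) {M t : ℝ} (hM : 0 < M) (ht : 0 < t)
    {w : E} (hw : ‖w‖ ≤ 1) (hwf : ∀ x, 1 / M ≤ ((f x : ℤ) : ℝ) * inner ℝ w (Ψ x))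
    {k : ℕ} {u : Fin k → E} (hu : Orthonormal ℝ u)
    (hres : ∀ w : E, ‖w‖ ≤ 1 → (∀ i, inner ℝ w (u i) = 0) →
      ∫ x, (inner ℝ w (Ψ x)) ^ 2 ∂D ≤ t ^ 2)
    (hclose : ∑ i, (correlation D f (fun x => inner ℝ (u i) (Ψ x)) -
      correlation D g (fun x => inner ℝ (u i) (Ψ x))) ^ 2 ≤ (2 * t) ^ 2) :
    D {x | f x ≠ g x} ≤ ENNReal.ofReal (2 * M * t) := by
  have hm : ∀ v : E, Measurable fun x => inner ℝ v (Ψ x) := fun v => measurable_const.inner hΨ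
  have hB : ∀ (v : E) x, |inner ℝ v (Ψ x)| ≤ ‖v‖ := fun v x =>
    (abs_real_inner_le_norm _ _).trans (mul_le_of_le_one_right (norm_nonneg _) (hb x))
  have hif : ∀ {h : X → ℤˣ}, Measurable h → ∀ v : E,
      Integrable (fun x => ((h x : ℤ) : ℝ) * inner ℝ v (Ψ x)) D :=
    fun hh v => integrable_unit_mul D hh (hm v) (hB v)
  let L : E → ℝ := fun v => ∫ x, ((f x : ℤ) : ℝ) * inner ℝ v (Ψ x) ∂D -
    ∫ x, ((g x : ℤ) : ℝ) * inner ℝ v (Ψ x) ∂D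
  have hL : ∀ v, L v = ∫ x, (((f x : ℤ) : ℝ) - ((g x : ℤ) : ℝ)) * inner ℝ v (Ψ x) ∂D := by
    intro v
    simp only [L, ← integral_sub (hif hf v) (hif hg v), sub_mul]
  have hLi : ∀ v, Integrable
      (fun x => (((f x : ℤ) : ℝ) - ((g x : ℤ) : ℝ)) * inner ℝ v (Ψ x)) D := by
    intro v
    simp only [sub_mul]
    exact (hif hf v).sub (hif hg v)
  let p : E := ∑ i, inner ℝ (u i) w • u i
  -- the component of `w` along the main directions
  have hadd : L w = ∑ i, inner ℝ (u i) w * L (u i) + L (w - p) := by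
    simp only [hL]
    simp_rw [← integral_const_mul]
    rw [← integral_finsetSum _ fun i _ => (hLi (u i)).const_mul _,
      ← integral_add (integrable_finsetSum _ fun i _ => (hLi (u i)).const_mul _) (hLi _)]
    congr 1
    ext x
    simp only [p, inner_sub_left, sum_inner, real_inner_smul_left]
    rw [mul_sub, Finset.mul_sum]
    have : ∀ i, inner ℝ (u i) w * ((((f x : ℤ) : ℝ) - ((g x : ℤ) : ℝ)) * inner ℝ (u i) (Ψ x)) =
        (((f x : ℤ) : ℝ) - ((g x : ℤ) : ℝ)) * (inner ℝ (u i) w * inner ℝ (u i) (Ψ x)) :=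
      fun i => by ring
    simp only [this]
    ring
  have horth : ∀ i, inner ℝ (w - p) (u i) = 0 := by
    intro i
    have := hu.inner_left_fintype (fun i => inner ℝ (u i) w) i
    simp only [conj_trivial] at this
    rw [inner_sub_left, this, real_inner_comm, sub_self]
  have hnorm : ‖w - p‖ ≤ 1 := by
    have h1 : inner ℝ (w - p) p = 0 := by
      simp only [p] at horth ⊢
      rw [inner_sum]
      exact Finset.sum_eq_zero fun i _ => by rw [real_inner_smul_right, horth, mul_zero]
    have h2 : ‖w - p‖ ^ 2 ≤ ‖w‖ * ‖w - p‖ := by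
      rw [← real_inner_self_eq_norm_sq]
      calc inner ℝ (w - p) (w - p) = inner ℝ w (w - p) := by
            rw [inner_sub_left w p (w - p), real_inner_comm (w - p) p, h1, sub_zero]
        _ ≤ _ := real_inner_le_norm _ _
    by_contra! h3
    nlinarith
  have hmain : ∑ i, inner ℝ (u i) w * L (u i) ≤ 2 * t := by
    have hbess : ∑ i, (inner ℝ (u i) w) ^ 2 ≤ 1 := by
      have := hu.sum_inner_products_le w (s := Finset.univ)
      simp only [Real.norm_eq_abs, sq_abs] at this
      exact this.trans (pow_le_one₀ (norm_nonneg _) hw)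
    -- Cauchy–Schwarz in the form `a * b ≤ t * a ^ 2 + b ^ 2 / (4 * t)`, whose weight makes both
    -- terms at most `t`.
    calc ∑ i, inner ℝ (u i) w * L (u i)
        ≤ ∑ i, (t * (inner ℝ (u i) w) ^ 2 + (L (u i)) ^ 2 / (4 * t)) := by
          refine Finset.sum_le_sum fun i _ => ?_
          have : t * (inner ℝ (u i) w) ^ 2 + (L (u i)) ^ 2 / (4 * t) - inner ℝ (u i) w * L (u i) =
            (2 * t * inner ℝ (u i) w - L (u i)) ^ 2 / (4 * t) := by field_simp; ring
          have h2 : 0 ≤ (2 * t * inner ℝ (u i) w - L (u i)) ^ 2 / (4 * t) := by positivity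
          linarith
      _ = t * ∑ i, (inner ℝ (u i) w) ^ 2 + (∑ i, (L (u i)) ^ 2) / (4 * t) := by
          rw [Finset.sum_add_distrib, Finset.mul_sum, Finset.sum_div]
      _ ≤ t * 1 + (2 * t) ^ 2 / (4 * t) := by gcongr; exact hclose
      _ = 2 * t := by field_simp; ring
  have hrest : L (w - p) ≤ 2 * t := by
    rw [hL]
    -- Here `|f - g| ≤ 2` and `2 * |s| ≤ s ^ 2 / t + t`.
    calc _ ≤ ∫ x, ((inner ℝ (w - p) (Ψ x)) ^ 2 / t + t) ∂D := by
          refine integral_mono (hLi _)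
            (((integrable_inner_sq D hΨ hb _).div_const _).add (integrable_const _)) fun x => ?_
          set s : ℝ := inner ℝ (w - p) (Ψ x)
          have h1 : s ^ 2 / t + t - 2 * s = (s - t) ^ 2 / t := by field_simp; ring
          have h2 : s ^ 2 / t + t + 2 * s = (s + t) ^ 2 / t := by field_simp; ring
          have h3 : 0 ≤ (s - t) ^ 2 / t := by positivity
          have h4 : 0 ≤ (s + t) ^ 2 / t := by positivity
          have h5 : 0 ≤ s ^ 2 / t + t := by positivity
          rcases Int.units_eq_one_or (f x) with h | h <;>
            rcases Int.units_eq_one_or (g x) with h' | h' <;> simp [h, h'] <;> linarith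
      _ = (∫ x, (inner ℝ (w - p) (Ψ x)) ^ 2 ∂D) / t + t := by
          rw [integral_add ((integrable_inner_sq D hΨ hb _).div_const _) (integrable_const _),
            integral_div]
          simp
      _ ≤ t ^ 2 / t + t := by gcongr; exact hres _ hnorm horth
      _ = 2 * t := by field_simp; ring
  have hset : MeasurableSet {x | f x ≠ g x} := (measurableSet_eq_fun hf hg).compl
  -- Where the labels differ, `f - g = 2 * f`, so the margin gives at least `2 / M`; elsewhere the
  -- integrand vanishes.
  have hlow : 2 / M * D.real {x | f x ≠ g x} ≤ L w := by
    rw [hL, mul_comm, ← smul_eq_mul, ← setIntegral_const, ← integral_indicator hset]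
    refine integral_mono ((integrable_const _).indicator hset) (hLi w) fun x => ?_
    have hx := hwf x
    have h2 : 2 / M = 1 / M + 1 / M := by ring
    by_cases hfg : f x = g x
    · simp [hfg]
    · rw [Set.indicator_of_mem (by exact hfg), h2]
      rcases Int.units_eq_one_or (f x) with h | h <;>
        rcases Int.units_eq_one_or (g x) with h' | h' <;> simp [h, h'] at hfg hx ⊢ <;> linarith
  have hfin : 2 / M * D.real {x | f x ≠ g x} ≤ 4 * t := by linarith
  rw [← ENNReal.ofReal_toReal (measure_ne_top D {x | f x ≠ g x})]
  refine ENNReal.ofReal_le_ofReal ?_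
  rw [div_mul_eq_mul_div, div_le_iff₀ hM] at hfin
  change D.real {x | f x ≠ g x} ≤ _
  linarith

end Separation

/-! ### Randomized response -/

section RandomizedResponse

/-- The real sign encoded by a Boolean. -/
def boolSign (b : Bool) : ℝ := cond b 1 (-1)

theorem abs_boolSign (b : Bool) : |boolSign b| = 1 := by cases b <;> simp [boolSign]

theorem randomizedResponse_nonneg {t : ℝ} (ht : |t| ≤ 1) (b : Bool) :
    0 ≤ (1 + boolSign b * t) / 2 := by
  have := abs_le.1 ht
  cases b <;> simp [boolSign] <;> linarith

/-- The law of a random sign with mean `t`. -/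
def randomizedResponse (t : ℝ) (ht : |t| ≤ 1) : PMF Bool :=
  PMF.ofFintype (fun b => ENNReal.ofReal ((1 + boolSign b * t) / 2)) <| by
    rw [← ENNReal.ofReal_sum_of_nonneg fun b _ => randomizedResponse_nonneg ht b]
    simp only [Fintype.sum_bool, boolSign, cond_true, cond_false]
    rw [← ENNReal.ofReal_one]
    congr 1
    ring

theorem randomizedResponse_apply {t : ℝ} (ht : |t| ≤ 1) (b : Bool) :
    randomizedResponse t ht b = ENNReal.ofReal ((1 + boolSign b * t) / 2) := rfl

theorem integral_boolSign_randomizedResponse {t : ℝ} (ht : |t| ≤ 1) :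
    ∫ b, boolSign b ∂(randomizedResponse t ht).toMeasure = t := by
  rw [PMF.integral_eq_sum]
  simp only [Fintype.sum_bool, randomizedResponse_apply,
    ENNReal.toReal_ofReal (randomizedResponse_nonneg ht _)]
  simp [boolSign]
  ring

theorem abs_label_mul_le {X : Type*} {c : ℝ} (hc : 0 ≤ c) {φ : X → ℝ} (hφ : ∀ x, |φ x| ≤ 1) (z : X × ℤˣ) :
    |c * (((z.2 : ℤ) : ℝ) * φ z.1)| ≤ c := by
  rw [abs_mul, abs_mul, abs_unit_cast, one_mul, abs_of_nonneg hc]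
  exact mul_le_of_le_one_right hc (hφ _)

variable {X : Type*} [MeasurableSpace X]

/-- Randomized response to the query `y * φ x` about a labeled example `(x, y)`, with bias `c`. -/
def correlationRandomizer {ε c : ℝ} (hc : 0 ≤ c) (hc1 : c < 1)
    (hε : 1 + c ≤ Real.exp ε * (1 - c)) (φ : X → ℝ) (hm : Measurable φ) (hφ : ∀ x, |φ x| ≤ 1) :
    LocalRandomizer (X × ℤˣ) ε where
  W := Bool
  law z := randomizedResponse (c * (((z.2 : ℤ) : ℝ) * φ z.1))
    ((abs_label_mul_le hc hφ z).trans hc1.le)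
  measurable_law b := by
    simp only [randomizedResponse_apply]
    have h : Measurable fun z : X × ℤˣ => ((z.2 : ℤ) : ℝ) * φ z.1 :=
      (measurable_unit_cast measurable_snd).mul (hm.comp measurable_fst)
    exact ((((h.const_mul c).const_mul _).const_add 1).div_const 2).ennreal_ofReal
  law_le z₁ z₂ b := by
    simp only [randomizedResponse_apply]
    rw [← ENNReal.ofReal_mul (Real.exp_pos _).le]
    refine ENNReal.ofReal_le_ofReal ?_
    -- All answer probabilities lie between `(1 - c) / 2` and `(1 + c) / 2`, whose ratio is at most
    -- `exp ε` by `hε`.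
    have h : ∀ z : X × ℤˣ, |boolSign b * (c * (((z.2 : ℤ) : ℝ) * φ z.1))| ≤ c := fun z => by
      rw [abs_mul, abs_boolSign, one_mul]
      exact abs_label_mul_le hc hφ z
    have h1 := (abs_le.1 (h z₁)).2
    have h2 := (abs_le.1 (h z₂)).1
    have h3 : Real.exp ε * (1 - c) ≤
        Real.exp ε * (1 + boolSign b * (c * (((z₂.2 : ℤ) : ℝ) * φ z₂.1))) := by gcongr; linarith
    linarith

theorem abs_mul_correlation_le {D : Measure X} [IsProbabilityMeasure D] (f : X → ℤˣ) {c : ℝ}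
    (hc : 0 ≤ c) (hc1 : c < 1) {φ : X → ℝ} (hφ : ∀ x, |φ x| ≤ 1) :
    |c * correlation D f φ| ≤ 1 := by
  rw [abs_mul, abs_of_nonneg hc]
  exact mul_le_one₀ hc1.le (abs_nonneg _) (abs_correlation_le D f hφ)

/-- The law of a random sign is affine in its mean, so averaging over the example only replaces the
mean by its expectation. -/
theorem lintegral_correlationRandomizer {ε c : ℝ} (hc : 0 ≤ c) (hc1 : c < 1)
    (hε : 1 + c ≤ Real.exp ε * (1 - c)) {φ : X → ℝ} (hm : Measurable φ) (hφ : ∀ x, |φ x| ≤ 1)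
    (D : Measure X) [IsProbabilityMeasure D] {f : X → ℤˣ} (hf : Measurable f) (b : Bool) :
    ∫⁻ z, (correlationRandomizer hc hc1 hε φ hm hφ).law z b ∂(exampleDistribution D f) =
      randomizedResponse (c * correlation D f φ) (abs_mul_correlation_le f hc hc1 hφ) b := by
  refine (lintegral_map ((correlationRandomizer hc hc1 hε φ hm hφ).measurable_law b)
    (measurable_id.prodMk hf)).trans ?_
  have hi := integrable_unit_mul D hf hm hφ
  have h1 : Integrable (fun x => (1 + boolSign b * (c * (((f x : ℤ) : ℝ) * φ x))) / 2) D :=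
    (((integrable_const 1).add ((hi.const_mul c).const_mul _))).div_const 2
  change ∫⁻ x, ENNReal.ofReal ((1 + boolSign b * (c * (((f x : ℤ) : ℝ) * φ x))) / 2) ∂D = _
  rw [← ofReal_integral_eq_lintegral_ofReal h1 (ae_of_all _ fun x => randomizedResponse_nonneg
    ((abs_label_mul_le hc hφ (x, f x)).trans hc1.le) b), randomizedResponse_apply, integral_div,
    integral_add (integrable_const 1) ((hi.const_mul c).const_mul _), integral_const_mul,
    integral_const_mul]
  simp [correlation]

end RandomizedResponse

/-! ### Concentration of group means -/

section Deviation

/-- The mean of the answers in the `i`-th group, each group having `N` members. -/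
def groupMean {n k : ℕ} (a : Fin n → Fin k) (N : ℕ) (r : Fin n → Bool) (i : Fin k) : ℝ :=
  ∑ j, if a j = i then boolSign (r j) / N else 0

/-- Group means of independent random signs are simultaneously close to their expectations. -/
theorem two_thirds_le_groupMean_close {n k N : ℕ} (a : Fin n → Fin k) (hN : 0 < N)
    (ha : ∀ i, (Finset.univ.filter fun j => a j = i).card = N) {m : Fin k → ℝ}
    (hm : ∀ i, |m i| ≤ 1) {s : ℝ} (hs : 0 < s) (hks : 3 * k ≤ N * s) :
    2 / 3 ≤ Measure.pi (fun j => (randomizedResponse (m (a j)) (hm (a j))).toMeasure)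
      {r | ∑ i, (groupMean a N r i - m i) ^ 2 ≤ s} := by
  set ν : Fin n → Measure Bool := fun j => (randomizedResponse (m (a j)) (hm (a j))).toMeasure
  set μ := Measure.pi ν
  have hN' : (0 : ℝ) < N := by exact_mod_cast hN
  let Y : Fin k → Fin n → Bool → ℝ := fun i j b => if a j = i then boolSign b / N else 0
  have hcard : ∀ i (x : ℝ), ∑ j, (if a j = i then x else 0) = N * x := by
    intro i x
    rw [← Finset.sum_filter, Finset.sum_const, ha, nsmul_eq_mul]
  have hmean : ∀ i, ∫ r, groupMean a N r i ∂μ = m i := by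
    intro i
    have h1 : ∀ j, ∫ r : Fin n → Bool, Y i j (r j) ∂μ = if a j = i then m i / N else 0 := by
      intro j
      rw [show ∫ r : Fin n → Bool, Y i j (r j) ∂μ = ∫ b, Y i j b ∂ν j from
        integral_comp_eval (μ := ν) (measurable_of_finite (Y i j)).aestronglyMeasurable]
      by_cases h : a j = i
      · simp only [Y, h, if_true, integral_div, ν]
        rw [integral_boolSign_randomizedResponse]
      · simp [Y, h]
    change ∫ r, ∑ j, Y i j (r j) ∂μ = _
    rw [integral_finsetSum _ fun j _ => .of_finite]
    simp only [h1, hcard]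
    field_simp
  -- A group consists of `N` independent terms, each of variance at most `1 / N ^ 2`.
  have hvar : ∀ i, ∫ r, (groupMean a N r i - m i) ^ 2 ∂μ ≤ 1 / N := by
    intro i
    have h1 : Var[∑ j, fun r : Fin n → Bool => Y i j (r j); μ] = ∑ j, Var[Y i j; ν j] :=
      variance_sum_pi fun j => MemLp.of_discrete
    have h2 : (∑ j, fun r : Fin n → Bool => Y i j (r j)) = fun r => groupMean a N r i := by
      ext r
      simp [Y, groupMean]
    rw [h2, variance_eq_integral (measurable_of_finite _).aemeasurable, hmean] at h1
    rw [h1]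
    calc ∑ j, Var[Y i j; ν j] ≤ ∑ j, (if a j = i then (1 / (N : ℝ)) ^ 2 else 0) := by
          refine Finset.sum_le_sum fun j _ => ?_
          refine (variance_le_expectation_sq (measurable_of_finite _).aestronglyMeasurable).trans ?_
          by_cases h : a j = i
          · have : ∀ b, (boolSign b) ^ 2 = 1 := fun b => by rw [← sq_abs, abs_boolSign, one_pow]
            simp only [Y, h, if_true, Pi.pow_apply, div_pow, this, one_pow, integral_const,
              probReal_univ, one_smul, le_refl]
          · simp [Y, h]
      _ = 1 / N := by
          rw [hcard]
          field_simp
  set G : (Fin n → Bool) → ℝ := fun r => ∑ i, (groupMean a N r i - m i) ^ 2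
  have hG : ∫ r, G r ∂μ ≤ k / N := by
    rw [integral_finsetSum _ fun i _ => .of_finite]
    refine (Finset.sum_le_sum fun i _ => hvar i).trans ?_
    simp [div_eq_mul_inv]
  -- Markov's inequality for the total squared error treats all groups at once, without a union
  -- bound.
  have hmarkov : s * μ.real {r | s ≤ G r} ≤ ∫ r, G r ∂μ :=
    mul_meas_ge_le_integral_of_nonneg
      (ae_of_all _ fun r => Finset.sum_nonneg fun i _ => sq_nonneg _) .of_finite s
  have h3 : μ.real {r | s ≤ G r} ≤ 1 / 3 := by
    have : (k : ℝ) / N ≤ s / 3 := by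
      rw [div_le_iff₀ hN']
      linarith
    nlinarith
  have h4 : μ.real {r | G r ≤ s}ᶜ ≤ 1 / 3 :=
    (measureReal_mono fun r (hr : ¬ G r ≤ s) => (not_le.1 hr).le).trans h3
  rw [probReal_compl_eq_one_sub (Set.toFinite _).measurableSet] at h4
  rw [← ENNReal.ofReal_toReal (measure_ne_top μ {r | G r ≤ s}), show (2 / 3 : ℝ≥0∞) =
    ENNReal.ofReal (2 / 3) by rw [ENNReal.ofReal_div_of_pos (by norm_num)]; norm_num]
  refine ENNReal.ofReal_le_ofReal ?_
  change 2 / 3 ≤ μ.real _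
  linarith

end Deviation

/-! ### The correlation-estimating algorithm -/

section Algorithm

variable {X : Type*} [MeasurableSpace X] {H : Type*}

/-- Example `j` is asked once, by randomized response, about the feature of its group `a j`, and the
output is computed from the answers. -/
def correlationAlgorithm {ε c : ℝ} (hε0 : 0 ≤ ε) (hc : 0 ≤ c) (hc1 : c < 1)
    (hε : 1 + c ≤ Real.exp ε * (1 - c)) {n k : ℕ} (a : Fin n → Fin k) (φ : Fin k → X → ℝ)
    (hm : ∀ i, Measurable (φ i)) (hφ : ∀ i x, |φ i x| ≤ 1) (out : (Fin n → Bool) → H) :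
    NonInteractiveLDPAlgorithm (X × ℤˣ) H ε n where
  Coins := Unit
  coins := PMF.pure ()
  procedure _ :=
    { numCalls := n
      call := fun j =>
        { index := j
          eps := ε
          eps_nonneg := hε0
          randomizer := correlationRandomizer hc hc1 hε (φ (a j)) (hm _) (hφ _) }
      budget := fun i => by simp [Finset.filter_eq']
      output := out }

/-- Distinct calls use distinct, independent examples. Hence integrating out the dataset leaves
independent random signs, and the output probability is computed on the finite space of answers. -/
theorem correlationAlgorithm_prob {ε c : ℝ} (hε0 : 0 ≤ ε) (hc : 0 ≤ c) (hc1 : c < 1)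
    (hε : 1 + c ≤ Real.exp ε * (1 - c)) {n k : ℕ} (a : Fin n → Fin k) (φ : Fin k → X → ℝ)
    (hm : ∀ i, Measurable (φ i)) (hφ : ∀ i x, |φ i x| ≤ 1) (out : (Fin n → Bool) → H)
    (D : Measure X) [IsProbabilityMeasure D] {f : X → ℤˣ} (hf : Measurable f) (E : Set H) :
    (correlationAlgorithm hε0 hc hc1 hε a φ hm hφ out).prob (exampleDistribution D f) E =
      Measure.pi (fun j => (randomizedResponse (c * correlation D f (φ (a j)))
        (abs_mul_correlation_le f hc hc1 (hφ (a j)))).toMeasure) {r | out r ∈ E} := by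
  classical
  have hP : IsProbabilityMeasure (exampleDistribution D f) :=
    Measure.isProbabilityMeasure_map (measurable_id.prodMk hf).aemeasurable
  let q : Fin n → Bool → X × ℤˣ → ℝ≥0∞ := fun j b z =>
    (correlationRandomizer hc hc1 hε (φ (a j)) (hm _) (hφ _)).law z b
  have h1 : (correlationAlgorithm hε0 hc hc1 hε a φ hm hφ out).prob (exampleDistribution D f) E =
      ∑' c : Unit, PMF.pure () c * ∫⁻ S : Fin n → X × ℤˣ, ∑' r : {r : Fin n → Bool // out r ∈ E},
        ∏ j, q j (r.1 j) (S j) ∂(Measure.pi fun _ => exampleDistribution D f) := rfl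
  have hmeas : ∀ j b, Measurable (q j b) := fun j b =>
    (correlationRandomizer hc hc1 hε (φ (a j)) (hm _) (hφ _)).measurable_law b
  have hind : iIndepFun (fun j (S : Fin n → X × ℤˣ) => S j)
      (Measure.pi fun _ => exampleDistribution D f) :=
    iIndepFun_pi (X := fun _ z => z) fun _ => aemeasurable_id
  have hprod : ∀ r : Fin n → Bool,
      ∫⁻ S : Fin n → X × ℤˣ, ∏ j, q j (r j) (S j)
        ∂(Measure.pi fun _ => exampleDistribution D f) =
      Measure.pi (fun j => (randomizedResponse (c * correlation D f (φ (a j)))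
        (abs_mul_correlation_le f hc hc1 (hφ (a j)))).toMeasure) {r} := by
    intro r
    rw [lintegral_prod_eq_prod_lintegral_of_indepFun Finset.univ
      (fun j (S : Fin n → X × ℤˣ) => q j (r j) (S j))
      (hind.comp (fun j => q j (r j)) fun j => hmeas j _)
      fun j => (hmeas j _).comp (measurable_pi_apply j), Measure.pi_singleton]
    refine Finset.prod_congr rfl fun j _ => ?_
    rw [PMF.toMeasure_apply_singleton _ _ (measurableSet_singleton _),
      ← lintegral_correlationRandomizer hc hc1 hε (hm (a j)) (hφ (a j)) D hf]
    exact (measurePreserving_eval (fun _ => exampleDistribution D f) j).lintegral_comp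
      (hmeas j (r j))
  have hmeasP : ∀ r : {r : Fin n → Bool // out r ∈ E},
      AEMeasurable (fun S : Fin n → X × ℤˣ => ∏ j, q j (r.1 j) (S j))
        (Measure.pi fun _ => exampleDistribution D f) := fun r =>
    (Finset.measurable_prod _ fun j _ => (hmeas j _).comp (measurable_pi_apply j)).aemeasurable
  rw [h1, tsum_fintype, Fintype.sum_unique, PMF.pure_apply, if_pos rfl, one_mul,
    lintegral_tsum hmeasP]
  simp only [hprod]
  rw [← Measure.tsum_indicator_apply_singleton _ _ (Set.toFinite _).measurableSet, ← tsum_subtype]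
  rfl

end Algorithm

/-! ### The trivial algorithm and the learner -/

/-- The algorithm that uses no examples and outputs `h`. -/
def constantAlgorithm (Z : Type*) [MeasurableSpace Z] {H : Type*} (ε : ℝ) (h : H) :
    NonInteractiveLDPAlgorithm Z H ε 0 where
  Coins := Unit
  coins := PMF.pure ()
  procedure _ :=
    { numCalls := 0
      call := Fin.elim0
      budget := fun i => i.elim0
      output := fun _ => h }

theorem constantAlgorithm_prob {Z : Type*} [MeasurableSpace Z] {H : Type*} {ε : ℝ} {h : H}
    (P : Measure Z) {E : Set H} (hE : h ∈ E) :
    (constantAlgorithm Z ε h).prob P E = 1 := by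
  have h1 : (constantAlgorithm Z ε h).prob P E = ∑' c : Unit, PMF.pure () c *
      ∫⁻ S : Fin 0 → Z, ∑' _r : {_r : ∀ j : Fin 0,
        ((Fin.elim0 j : OracleCall Z 0)).randomizer.W // h ∈ E}, 1
        ∂(Measure.pi fun _ => P) := rfl
  rw [h1, tsum_fintype, Fintype.sum_unique, PMF.pure_apply, if_pos rfl, one_mul]
  have : Unique {_r : ∀ j : Fin 0, ((Fin.elim0 j : OracleCall Z 0)).randomizer.W // h ∈ E} :=
    ⟨⟨⟨fun j => j.elim0, hE⟩⟩, fun r => Subtype.ext (funext fun j => j.elim0)⟩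
  simp

/-- Learning with error `2 * M * t`: the correlations of the target with few main directions are
estimated, and any function of the class matching the estimates is output. -/
theorem exists_learner {X : Type*} [MeasurableSpace X] {C : Set (X → ℤˣ)} (D : Measure X)
    [IsProbabilityMeasure D] (hC : ∀ f ∈ C, Measurable f) {M : ℝ} (hM : 0 < M)
    (h : RealizableWithMargin C M) {t : ℝ} (ht : 0 < t) {ε c : ℝ} (hε0 : 0 ≤ ε) (hc : 0 < c)
    (hc1 : c < 1) (hε : 1 + c ≤ Real.exp ε * (1 - c)) {N : ℕ} (hN : 0 < N)
    (hNt : 3 / t ^ 2 ≤ N * (c * t) ^ 2) :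
    ∃ (k : ℕ) (A : NonInteractiveLDPAlgorithm (X × ℤˣ) {h : X → ℤˣ // Measurable h} ε (k * N)),
      k * t ^ 2 ≤ 1 ∧ PACLearnsRelativeTo A C D (2 * M * t) := by
  classical
  obtain ⟨d, Ψ, hΨ, hb, hw⟩ := h.exists_measurable hC hM
  obtain ⟨k, u, hu, hk, hres⟩ :=
    exists_orthonormal_second_moment_le D hΨ hb (l := t ^ 2) (by positivity)
  let φ : Fin k → X → ℝ := fun i x => inner ℝ (u i) (Ψ x)
  have hm : ∀ i, Measurable (φ i) := fun i => measurable_const.inner hΨ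
  have hφ : ∀ i x, |φ i x| ≤ 1 := fun i x =>
    (abs_real_inner_le_norm _ _).trans (mul_le_one₀ (hu.1 i).le (norm_nonneg _) (hb x))
  let a : Fin (k * N) → Fin k := fun j => (finProdFinEquiv.symm j).1
  have ha : ∀ i, (Finset.univ.filter fun j => a j = i).card = N := by
    intro i
    have : (Finset.univ.filter fun j => a j = i) =
        (Finset.univ : Finset (Fin N)).map
          ⟨fun y => finProdFinEquiv (i, y), fun y z hyz => by simpa using hyz⟩ := by
      ext j
      obtain ⟨⟨x, y⟩, rfl⟩ := finProdFinEquiv.surjective j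
      simp only [a, Finset.mem_filter, Finset.mem_map, Finset.mem_univ, true_and,
        Equiv.symm_apply_apply]
      exact ⟨fun h => ⟨y, by rw [← h]; rfl⟩,
        fun ⟨_, h⟩ => (congrArg Prod.fst (finProdFinEquiv.injective h)).symm⟩
    rw [this, Finset.card_map, Finset.card_univ, Fintype.card_fin]
  -- The answers estimate `c` times the correlations, so the tolerance `t` is scaled by `c` too.
  let good : (X → ℤˣ) → (Fin (k * N) → Bool) → Prop := fun g r =>
    ∑ i, (groupMean a N r i - c * correlation D g (φ i)) ^ 2 ≤ (c * t) ^ 2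
  let out : (Fin (k * N) → Bool) → {h : X → ℤˣ // Measurable h} := fun r =>
    if hr : ∃ g ∈ C, good g r then ⟨hr.choose, hC _ hr.choose_spec.1⟩
    else ⟨fun _ => 1, measurable_const⟩
  refine ⟨k, correlationAlgorithm hε0 hc.le hc1 hε a φ hm hφ out, hk, fun f hf => ?_⟩
  rw [correlationAlgorithm_prob hε0 hc.le hc1 hε a φ hm hφ out D (hC f hf)]
  have hks : 3 * (k : ℝ) ≤ N * (c * t) ^ 2 := by
    refine le_trans ?_ hNt
    rw [le_div_iff₀ (by positivity)]
    linarith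
  refine (two_thirds_le_groupMean_close a hN ha
    (fun i => abs_mul_correlation_le f hc.le hc1 (hφ i)) (by positivity) hks).trans
    (measure_mono fun r hr => ?_)
  have hex : ∃ g ∈ C, good g r := ⟨f, hf, hr⟩
  obtain ⟨hgC, hg⟩ := hex.choose_spec
  set g := hex.choose
  have hout : (out r).1 = g := by simp only [out, dif_pos hex, g]
  change D {x | f x ≠ (out r).1 x} ≤ _
  rw [hout]
  obtain ⟨w, hw1, hwf⟩ := hw f hf
  refine measure_ne_le_of_correlation_close D hΨ hb (hC f hf) (hC g hgC) hM ht hw1 hwf hu hres ?_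
  -- Both `f` and `g` are within `c * t` of the estimates, hence within `2 * c * t` of each other;
  -- dividing by `c` gives `2 * t`.
  have hsum : c ^ 2 * ∑ i, (correlation D f (φ i) - correlation D g (φ i)) ^ 2 ≤
      c ^ 2 * (2 * t) ^ 2 := by
    calc c ^ 2 * ∑ i, (correlation D f (φ i) - correlation D g (φ i)) ^ 2
        ≤ ∑ i, (2 * (groupMean a N r i - c * correlation D f (φ i)) ^ 2 +
            2 * (groupMean a N r i - c * correlation D g (φ i)) ^ 2) := by
          rw [Finset.mul_sum]
          refine Finset.sum_le_sum fun i _ => ?_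
          linarith [sq_nonneg ((groupMean a N r i - c * correlation D f (φ i)) +
            (groupMean a N r i - c * correlation D g (φ i)))]
      _ = 2 * ∑ i, (groupMean a N r i - c * correlation D f (φ i)) ^ 2 +
            2 * ∑ i, (groupMean a N r i - c * correlation D g (φ i)) ^ 2 := by
          rw [Finset.sum_add_distrib, Finset.mul_sum, Finset.mul_sum]
      _ ≤ 2 * (c * t) ^ 2 + 2 * (c * t) ^ 2 := by gcongr; exact hr
      _ = c ^ 2 * (2 * t) ^ 2 := by ring
  exact le_of_mul_le_mul_left hsum (by positivity)

end LDPLearning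
end

/-! ### Choice of parameters -/

theorem mainTheorem5 :
    ∃ p : Polynomial ℝ,
      ∀ (X : Type*) [MeasurableSpace X] (C : Set (X → ℤˣ)) (D : Measure X) [IsProbabilityMeasure D]
        (α ε : ℝ),
        (∀ f ∈ C, Measurable f) → LDPLearning.marginComplexity C ≠ ⊤ → 0 < α → 0 < ε →
        ∃ (n : ℕ) (A : LDPLearning.NonInteractiveLDPAlgorithm (X × ℤˣ)
            {h : X → ℤˣ // Measurable h} ε n),
          (n : ℝ) ≤ p.eval ((LDPLearning.marginComplexity C).toReal / (α * min ε 1)) ∧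
          LDPLearning.PACLearnsRelativeTo A C D α := by
  -- With `T` the argument of the polynomial, there are at most `16 * T ^ 2` groups of at most `6914
  -- * T ^ 4` examples.
  refine ⟨Polynomial.C 110624 * Polynomial.X ^ 6, fun X _ C D _ α ε hC hmc hα hε => ?_⟩
  simp only [Polynomial.eval_mul, Polynomial.eval_C, Polynomial.eval_pow, Polynomial.eval_X]
  set m := (LDPLearning.marginComplexity C).toReal with hm
  set e := min ε 1 with he
  have he0 : 0 < e := lt_min hε one_pos
  have he1 : e ≤ 1 := min_le_right _ _
  -- Outside these trivial cases `T ≥ 1`, which lets rounding terms be absorbed into powers of `T`.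
  by_cases htriv : C = ∅ ∨ 1 ≤ α
  · refine ⟨0, LDPLearning.constantAlgorithm _ ε ⟨fun _ => 1, measurable_const⟩, ?_,
      fun f hf => ?_⟩
    · rw [Nat.cast_zero]
      positivity
    · rcases htriv with rfl | h1
      · exact hf.elim
      · rw [LDPLearning.constantAlgorithm_prob]
        · exact ENNReal.div_le_of_le_mul (by norm_num)
        · exact prob_le_one.trans (by simpa using h1)
  push Not at htriv
  obtain ⟨hCne, hα1⟩ := htriv
  have hX : Nonempty X := D.nonempty_of_neZero
  obtain ⟨hm1, M, hM, hreal, hMm⟩ :=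
    LDPLearning.exists_realizable_le_two_mul_marginComplexity hCne hmc
  rw [← hm] at hm1 hMm
  set T := m / (α * e) with hT
  have hαe : α * e ≤ 1 := mul_le_one₀ hα1.le he0.le he1
  have hT1 : 1 ≤ T := by
    rw [hT, le_div_iff₀ (by positivity)]
    linarith
  have hMα : M / α ≤ 2 * T := by
    rw [hT, div_le_iff₀ hα]
    calc M ≤ 2 * m := hMm
      _ ≤ 2 * (m / e) := by
        gcongr
        exact le_div_self (by linarith) he0 he1
      _ = 2 * (m / (α * e)) * α := by field_simp
  have hMαe : M / (α * e) ≤ 2 * T := by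
    rw [hT, ← mul_div_assoc]
    gcongr
  -- This makes the error `2 * M * t` equal to `α`.
  set t := α / (2 * M) with ht
  have ht0 : 0 < t := by positivity
  set B := 3 / t ^ 2 / (e / 3 * t) ^ 2 with hB
  have hBT : B ≤ 6912 * T ^ 4 := by
    calc B = 432 * (M / α) ^ 2 * (M / (α * e)) ^ 2 := by
          rw [hB, ht]
          field_simp
          norm_num
      _ ≤ 432 * (2 * T) ^ 2 * (2 * T) ^ 2 := by gcongr
      _ = 6912 * T ^ 4 := by ring
  -- The bias `e / 3` works because `(1 + e) * (1 - e / 3) ≥ 1 + e / 3` for `0 ≤ e ≤ 1`.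
  have hexp : 1 + e / 3 ≤ Real.exp ε * (1 - e / 3) := by
    have h1 : 1 + e ≤ Real.exp ε :=
      (add_comm 1 e).trans_le ((Real.add_one_le_exp e).trans (Real.exp_le_exp.2 (min_le_left _ _)))
    have h2 : (1 + e) * (1 - e / 3) ≤ Real.exp ε * (1 - e / 3) := by
      gcongr
      linarith
    nlinarith
  obtain ⟨k, A, hk, hA⟩ := LDPLearning.exists_learner D hC hM hreal ht0 hε.le
    (c := e / 3) (by positivity) (by linarith) hexp (N := ⌈B⌉₊ + 1) (Nat.succ_pos _) (by
      rw [← div_le_iff₀ (by positivity), ← hB]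
      push_cast
      linarith [Nat.le_ceil B])
  refine ⟨_, A, ?_, ?_⟩
  · have hkT : (k : ℝ) ≤ 16 * T ^ 2 := by
      calc (k : ℝ) ≤ 1 / t ^ 2 := by rwa [le_div_iff₀ (by positivity)]
        _ = 4 * (M / α) ^ 2 := by
          rw [ht]
          field_simp
          norm_num
        _ ≤ 4 * (2 * T) ^ 2 := by gcongr
        _ = 16 * T ^ 2 := by ring
    have hNT : ((⌈B⌉₊ + 1 : ℕ) : ℝ) ≤ 6914 * T ^ 4 := by
      have h1 := (Nat.ceil_lt_add_one (show 0 ≤ B by positivity)).le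
      have h2 : 1 ≤ T ^ 4 := one_le_pow₀ hT1
      push_cast
      linarith
    rw [Nat.cast_mul]
    calc (k : ℝ) * ((⌈B⌉₊ + 1 : ℕ) : ℝ) ≤ 16 * T ^ 2 * (6914 * T ^ 4) := by gcongr
      _ = 110624 * T ^ 6 := by ring
  · have : 2 * M * t = α := by
      rw [ht]
      field_simp
    rwa [this] at hA
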